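/- **Setting.** Let $T$ be a weighted tree with positive edge weights and let $V$ be a finite set of $N$ (overlay) nodes contained in the vertex set of $T$. Let $d_T(v,w)$ be the weighted length of the unique simple path between $v$ and $w$ in $T$, and assume that distinct pairs $\{v,w\}$ of distinct nodes of $V$ have distinct distances. For $u,v,w\in V$ write $u\prec(v,w)$ if $d_T(u,v)<d_T(v,w)$ and $d_T(u,w)<d_T(v,w)$. **Configurations.** In a configuration $c$ every node $v$ stores a set $N_v\subseteq V\setminus\{v\}$ of references to other nodes, and has a channel, a finite multiset of messages each carrying a reference to a node of $V\setminus\{v\}$. The edge $(v,w)$ is explicit if $w\in N_v$, and implicit if a reference to $w$ is in the channel of $v$. Let $G_c^*$ be the undirected graph on $V$ formed by all explicit and implicit edges. An edge $\{v,w\}$ is valid in $c$ if it belongs to the minimum spanning tree, with respect to $d_T$ and over all possible edges, of the vertex set of some connected component of $G_c^*$. The configuration $c$ is legal if $(v,w)$ is explicit exactly when $\{v,w\}$ is valid, and every implicit edge is valid. **The protocol BuildMST.** In each step one node $v$ is activated and an arbitrary, possibly empty, set of messages of its channel is delivered to it. The delivered references are added to $N_v$. Then $v$ goes through all $w\in N_v$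 one after the other, in arbitrary order: if some $u$ in the current $N_v$ has $u\prec(v,w)$, then $v$ sends a reference to $w$ to some such $u$ and deletes $w$ from $N_v$; otherwise $v$ sends a reference to itself to $w$. A computation is an infinite sequence of such steps, starting in an arbitrary configuration, in which every node is activated again and again and every message is eventually delivered. It is divided into consecutive asynchronous rounds such that in each round every node is activated at least once and every message that is in a channel at the beginning of the round is delivered during the round. **Theorem.** BuildMST reaches a legal configuration within $O(N^2)$ asynchronous rounds. More precisely, there is an absolute constant $C$ such that for all such $T$ and $V$, every computation of BuildMST and every division of it into rounds: 1. after $CN^2$ rounds, all valid edges are explicit in both directions, and this holds from then on; 2. if all valid edges are explicit in both directions at the beginning of some round, then after $CN^2$ further rounds there is no invalid edge, explicit or implicit, and this holds from then on; 3. after $CN^2$ rounds the configuration is legal, and all later configurations are legal. -/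

import Mathlib

/-- A weighted tree: a tree together with a positive weight for each of its edges. -/
structure WeightedTree (W : Type*) where
  /-- the underlying graph -/
  graph : SimpleGraph W
  isTree : graph.IsTree
  /-- the edge weights (only the values on edges of the tree matter) -/
  weight : Sym2 W → ℝ
  weight_pos : ∀ e ∈ graph.edgeSet, 0 < weight e

namespace WeightedTree

/-- The unique simple path between two vertices of the tree. -/
noncomputable def path {W : Type*} (T : WeightedTree W) (x y : W) : T.graph.Walk x y :=
  (T.isTree.existsUnique_path x y).choose

/-- The weighted length of the unique simple path between two vertices of the tree. -/
noncomputable def dist {W : Type*} (T : WeightedTree W) (x y : W) : ℝ :=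
  ((T.path x y).edges.map T.weight).sum

theorem dist_comm {W : Type*} (T : WeightedTree W) (x y : W) : T.dist x y = T.dist y x := by
  have hx := (T.isTree.existsUnique_path x y).choose_spec
  have hy := (T.isTree.existsUnique_path y x).choose_spec
  have h : (T.path y x).reverse = T.path x y := hx.2 _ hy.1.reverse
  unfold dist
  rw [← h, SimpleGraph.Walk.edges_reverse, List.map_reverse, List.sum_reverse]

/-- The tree metric induced on a set `V` of overlay nodes sitting inside the vertex set of the
tree, as a function of the unordered pair of nodes. -/
noncomputable def metricOn {W V : Type*} (T : WeightedTree W) (ι : V ↪ W) : Sym2 V → ℝ :=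
  Sym2.lift ⟨fun u v => T.dist (ι u) (ι v), fun u v => T.dist_comm (ι u) (ι v)⟩

end WeightedTree

/-- Distinct pairs of nodes have distinct distances. -/
def DistinctDistances {V : Type*} (d : Sym2 V → ℝ) : Prop :=
  ∀ e e' : Sym2 V, ¬ e.IsDiag → ¬ e'.IsDiag → d e = d e' → e = e'

/-- `u ≺ (v, w)`: the node `u` is strictly closer to both `v` and `w` than these are to
each other. -/
def Closer {V : Type*} (d : Sym2 V → ℝ) (u v w : V) : Prop :=
  d s(u, v) < d s(v, w) ∧ d s(u, w) < d s(v, w)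

/-- The edge set `M` consists of edges between distinct nodes of `S`, and `(S, M)` is a
connected graph. -/
def ConnectsAll {V : Type*} (S : Set V) (M : Finset (Sym2 V)) : Prop :=
  (∀ e ∈ M, ¬ e.IsDiag ∧ ∀ v ∈ e, v ∈ S) ∧
    ((SimpleGraph.fromEdgeSet (M : Set (Sym2 V))).induce S).Connected

/-- `M` is a minimum spanning tree of the node set `S` over all possible edges. -/
def IsMST {V : Type*} (d : Sym2 V → ℝ) (S : Set V) (M : Finset (Sym2 V)) : Prop :=
  ConnectsAll S M ∧ ∀ M' : Finset (Sym2 V), ConnectsAll S M' → ∑ e ∈ M, d e ≤ ∑ e ∈ M', d e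

/-- A configuration: every node `v` stores a finite set `nbr v` of references to other nodes, and
its channel `chan v` is a finite multiset of messages, each carrying one reference to another
node. -/
structure Config (V : Type*) where
  /-- the references stored in the local memory of a node -/
  nbr : V → Finset V
  /-- the references contained in the messages of a node's channel -/
  chan : V → Multiset V
  self_notMem_nbr : ∀ v, v ∉ nbr v
  self_notMem_chan : ∀ v, v ∉ chan v

namespace Config

/-- `(v, w)` is an explicit edge: `v` stores a reference to `w`. -/
def Explicit {V : Type*} (c : Config V) (v w : V) : Prop := w ∈ c.nbr v

/-- `(v, w)` is an implicit edge: a reference to `w` is in the channel of `v`. -/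
def Implicit {V : Type*} (c : Config V) (v w : V) : Prop := w ∈ c.chan v

/-- The undirected graph of all explicit and implicit edges. -/
def graph {V : Type*} (c : Config V) : SimpleGraph V :=
  SimpleGraph.fromRel fun v w => c.Explicit v w ∨ c.Implicit v w

/-- `{v, w}` is valid: it is an edge of the minimum spanning tree of some connected component of
the graph of the configuration. -/
def Valid {V : Type*} (d : Sym2 V → ℝ) (c : Config V) (v w : V) : Prop :=
  ∃ K : c.graph.ConnectedComponent, ∃ M : Finset (Sym2 V), IsMST d K.supp M ∧ s(v, w) ∈ M

/-- All valid edges are explicit, in both directions. -/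
def AllValidExplicit {V : Type*} (d : Sym2 V → ℝ) (c : Config V) : Prop :=
  ∀ v w, c.Valid d v w → c.Explicit v w

/-- No edge of the configuration, explicit or implicit, is invalid. -/
def NoInvalid {V : Type*} (d : Sym2 V → ℝ) (c : Config V) : Prop :=
  ∀ v w, c.Explicit v w ∨ c.Implicit v w → c.Valid d v w

/-- The legal configurations: the explicit edges are exactly the edges of the minimum spanning
trees of the connected components, and all implicit edges are among these. -/
def Legal {V : Type*} (d : Sym2 V → ℝ) (c : Config V) : Prop :=
  (∀ v w, c.Explicit v w ↔ c.Valid d v w) ∧ (∀ v w, c.Implicit v w → c.Valid d v w)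

end Config

/-- The channels after a message with a reference to `w` was sent to `u`. -/
def send {V : Type*} [DecidableEq V] (Q : V → Multiset V) (u w : V) : V → Multiset V :=
  Function.update Q u (w ::ₘ Q u)

/-- The loop of BuildMST at the node `v`. `RunLoop d v l S Q S' Q'` says that processing the
references of the list `l` one after the other can turn the memory `S` of `v` and the channels `Q`
into `S'` and `Q'`: the reference `w` is delegated to some `u` in the current memory with
`u ≺ (v, w)` if there is one, and otherwise `v` introduces itself to `w`. -/
inductive RunLoop {V : Type*} [DecidableEq V] (d : Sym2 V → ℝ) (v : V) :
    List V → Finset V → (V → Multiset V) → Finset V → (V → Multiset V) → Prop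
  | done (S : Finset V) (Q : V → Multiset V) : RunLoop d v [] S Q S Q
  | delegate {w u : V} {l : List V} {S S' : Finset V} {Q Q' : V → Multiset V}
      (hu : u ∈ S) (huw : Closer d u v w)
      (h : RunLoop d v l (S.erase w) (send Q u w) S' Q') : RunLoop d v (w :: l) S Q S' Q'
  | introduce {w : V} {l : List V} {S S' : Finset V} {Q Q' : V → Multiset V}
      (hw : ∀ u ∈ S, ¬ Closer d u v w)
      (h : RunLoop d v l S (send Q w v) S' Q') : RunLoop d v (w :: l) S Q S' Q'

/-- One step from `c` to `c'`: the node `v` is activated and the messages `D` of its channel are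
delivered. Their references join the memory of `v`, and then `v` executes its loop over its whole
memory, in an arbitrary order. -/
def Step {V : Type*} [DecidableEq V] (d : Sym2 V → ℝ) (v : V) (D : Multiset V)
    (c c' : Config V) : Prop :=
  D ≤ c.chan v ∧
  (∃ l : List V, l.Nodup ∧ l.toFinset = c.nbr v ∪ D.toFinset ∧
    RunLoop d v l (c.nbr v ∪ D.toFinset) (Function.update c.chan v (c.chan v - D))
      (c'.nbr v) c'.chan) ∧
  ∀ w, w ≠ v → c'.nbr w = c.nbr w

/-- The number of messages with a reference to `w` that are delivered to `v` in the steps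
`a, a + 1, …, b - 1`, if in step `t` the node `act t` is activated and receives `del t`. -/
def deliveredCount {V : Type*} [DecidableEq V] (act : ℕ → V) (del : ℕ → Multiset V)
    (a b : ℕ) (v w : V) : ℕ :=
  ∑ t ∈ Finset.Ico a b, if act t = v then (del t).count w else 0

/-- A computation of BuildMST from an arbitrary initial configuration `conf 0`, with weakly fair
execution and fair message receipt. -/
structure BuildMSTRun {V : Type*} [DecidableEq V] (d : Sym2 V → ℝ) where
  /-- the configurations -/
  conf : ℕ → Config V
  /-- the node activated in each step -/
  act : ℕ → V
  /-- the messages delivered to the activated node in each step -/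
  del : ℕ → Multiset V
  step : ∀ t, Step d (act t) (del t) (conf t) (conf (t + 1))
  fair_activation : ∀ v t, ∃ t', t ≤ t' ∧ act t' = v
  /-- Messages with the same receiver and content are interchangeable, so it is enough to count
  them: as many copies as are in the channel at time `t` are delivered after time `t`. -/
  fair_receipt : ∀ v w t, ∃ t', ((conf t).chan v).count w ≤ deliveredCount act del t t' v w

namespace BuildMSTRun

/-- The steps `a, …, b - 1` form an asynchronous round: every node is activated, and every message
that is in a channel at the beginning is delivered. -/
def IsRound {V : Type*} [DecidableEq V] {d : Sym2 V → ℝ} (X : BuildMSTRun d) (a b : ℕ) : Prop :=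
  (∀ v, ∃ t, a ≤ t ∧ t < b ∧ X.act t = v) ∧
  ∀ v w, ((X.conf a).chan v).count w ≤ deliveredCount X.act X.del a b v w

/-- The computation is divided into the rounds `R₀, R₁, …`, where `Rᵢ` begins with configuration
`r i` and ends where `Rᵢ₊₁` begins. -/
def IsRoundDivision {V : Type*} [DecidableEq V] {d : Sym2 V → ℝ} (X : BuildMSTRun d)
    (r : ℕ → ℕ) : Prop :=
  r 0 = 0 ∧ ∀ i, X.IsRound (r i) (r (i + 1))

end BuildMSTRun

/-!
In a metric that satisfies the four-point condition, a minimum spanning tree is determined locally.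
If every two consecutive edges `{a, b}`, `{b, c}` of a path are shorter than `{a, c}`, then the
second node of the path is strictly closer to both ends than these are to each other
(`closer_of_isPath`). Tree metrics satisfy the four-point condition (`WeightedTree.four_point`), so
the minimum spanning tree of a set of nodes is its relative neighbourhood graph: `{v, w}` is an edge
if and only if there is no `u` with `u ≺ (v, w)` (`IsMST.mem_iff`).

A step of BuildMST replaces an edge only by a path of shorter edges, and so it preserves the
connected components (`StepSpec.reachable_iff`); hence the set of valid edges never changes. Call a
pair short if it is connected by edges that are all shorter than its own distance. Short pairs stay
short, and a delegated edge becomes short. As there are at most `N²` pairs, there is a block of four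
rounds among the first `N² + 1` such blocks in which no pair becomes short. The edges that are not
short connect the components; in that block they become explicit in both directions and none is
delegated, so consecutive ones satisfy the local condition above. Therefore they include
the minimum spanning trees (`IsRoundDivision.allValidExplicit`), whose edges are never delegated.

When all valid edges are explicit, every invalid edge is delegated as soon as it is processed, and
replaced by a shorter one. So each round removes the longest invalid edges, and after `N²` rounds
there are none (`IsRoundDivision.noInvalid`).
-/

/-! ### Tree metrics -/

namespace WeightedTree

variable {W : Type*} (T : WeightedTree W)

theorem path_isPath (x y : W) : (T.path x y).IsPath :=
  (T.isTree.existsUnique_path x y).choose_spec.1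

theorem eq_path {x y : W} {p : T.graph.Walk x y} (hp : p.IsPath) : p = T.path x y :=
  (T.isTree.existsUnique_path x y).choose_spec.2 _ hp

theorem mem_support_path_comm {m x y : W} (h : m ∈ (T.path x y).support) :
    m ∈ (T.path y x).support := by
  rw [← T.eq_path (T.path_isPath x y).reverse, SimpleGraph.Walk.support_reverse]
  exact List.mem_reverse.2 h

/-- Any walk between two vertices of a tree visits all vertices of the path between them. -/
theorem support_path_subset {x y : W} (p : T.graph.Walk x y) :
    (T.path x y).support ⊆ p.support := by
  classical
  rw [← T.eq_path p.bypass_isPath]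
  exact p.support_bypass_subset_support

theorem support_path_left_subset {m x y : W} (h : m ∈ (T.path x y).support) :
    (T.path x m).support ⊆ (T.path x y).support := by
  classical
  exact List.Subset.trans (T.support_path_subset ((T.path x y).takeUntil m h))
    ((T.path x y).support_takeUntil_subset_support h)

/-- A vertex on the path between `x` and `y` lies on the path from any given vertex to `x`
or to `y`. -/
theorem mem_path_or_mem_path {m x y : W} (h : m ∈ (T.path x y).support) (w : W) :
    m ∈ (T.path w x).support ∨ m ∈ (T.path w y).support := by
  have := T.support_path_subset ((T.path x w).append (T.path w y)) h
  rw [SimpleGraph.Walk.mem_support_append_iff] at this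
  exact this.imp_left T.mem_support_path_comm

theorem dist_nonneg (x y : W) : 0 ≤ T.dist x y := by
  refine List.sum_nonneg fun a ha => ?_
  obtain ⟨e, he, rfl⟩ := List.mem_map.1 ha
  exact (T.weight_pos e (SimpleGraph.Walk.edges_subset_edgeSet _ he)).le

theorem dist_eq_add {m x y : W} (h : m ∈ (T.path x y).support) :
    T.dist x y = T.dist x m + T.dist m y := by
  classical
  have h1 := T.eq_path ((T.path_isPath x y).takeUntil h)
  have h2 := T.eq_path ((T.path_isPath x y).dropUntil h)
  unfold dist
  conv_lhs => rw [← SimpleGraph.Walk.take_spec (T.path x y) h]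
  rw [h1, h2, SimpleGraph.Walk.edges_append, List.map_append, List.sum_append]

/-- Three vertices of a tree have a median: a vertex on all three paths between them. The proof
walks from `x` to `y`; in each step to a neighbour, the path from `z` to the current vertex either is
extended by the new vertex or loses the old one. -/
theorem exists_median (z : W) {x y : W} (p : T.graph.Walk x y) (hp : p.IsPath) :
    ∃ m ∈ p.support, m ∈ (T.path z x).support ∧ m ∈ (T.path z y).support := by
  induction p with
  | nil =>
    exact ⟨_, List.mem_singleton_self _, SimpleGraph.Walk.end_mem_support _,
      SimpleGraph.Walk.end_mem_support _⟩
  | @cons x x' y h p ih =>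
    by_cases hx : x ∈ (T.path z y).support
    · exact ⟨x, by simp, by simp, hx⟩
    obtain ⟨m, hmp, hmx, hmy⟩ := ih hp.of_cons
    refine ⟨m, by simp [hmp], ?_, hmy⟩
    have h1 := T.support_path_subset ((T.path z x).concat h) hmx
    rw [SimpleGraph.Walk.support_concat, List.mem_append,
      List.mem_singleton] at h1
    rcases h1 with h1 | rfl
    · exact h1
    have h2 : x ∉ (T.path z m).support := fun h3 => hx (T.support_path_left_subset hmy h3)
    rw [← T.eq_path ((T.path_isPath z m).concat h2 h.symm)]
    simp

theorem dist_triangle (x y z : W) : T.dist x z ≤ T.dist x y + T.dist y z := by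
  obtain ⟨m, hm, hmx, hmz⟩ := T.exists_median y _ (T.path_isPath x z)
  rw [T.dist_eq_add hm, T.dist_comm x y, T.dist_eq_add hmx, T.dist_eq_add hmz, T.dist_comm m x]
  linarith [T.dist_nonneg y m]

/-- The four-point condition: the median `m` of `x`, `y`, `z` lies on the path from `w` to `x` or
to `z`, and hence one of the two sums on the right is the sum of the four distances to `m`. -/
theorem four_point (x y z w : W) :
    T.dist x z + T.dist y w ≤
      max (T.dist x w + T.dist y z) (T.dist x y + T.dist z w) := by
  obtain ⟨m, hxy, hzx, hzy⟩ := T.exists_median z _ (T.path_isPath x y)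
  have e1 := T.dist_eq_add hxy
  have e2 := T.dist_eq_add hzx
  have e3 := T.dist_eq_add hzy
  have t2 := T.dist_triangle w m y
  rw [T.dist_comm x z, T.dist_comm y w, T.dist_comm x w, T.dist_comm y z, T.dist_comm z w]
  rw [T.dist_comm x m] at e1
  rw [T.dist_comm z m] at e2 e3
  rw [le_max_iff]
  rcases T.mem_path_or_mem_path hzx w with h | h
  · right
    linarith [T.dist_eq_add h]
  · left
    linarith [T.dist_eq_add h]

end WeightedTree

/-- The four-point condition for a function of unordered pairs: among the three sums of two
opposite distances of four points, each is at most the maximum of the other two. -/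
def FourPoint {V : Type*} (d : Sym2 V → ℝ) : Prop :=
  ∀ x y z w, d s(x, z) + d s(y, w) ≤ max (d s(x, w) + d s(y, z)) (d s(x, y) + d s(z, w))

theorem WeightedTree.fourPoint_metricOn {W V : Type*} (T : WeightedTree W) (ι : V ↪ W) :
    FourPoint (T.metricOn ι) :=
  fun x y z w => T.four_point (ι x) (ι y) (ι z) (ι w)

theorem WeightedTree.metricOn_nonneg {W V : Type*} (T : WeightedTree W) (ι : V ↪ W)
    (e : Sym2 V) : 0 ≤ T.metricOn ι e := by
  induction e with
  | _ x y => exact T.dist_nonneg (ι x) (ι y)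

/-! ### Paths with a local monotonicity property -/

/-- In a path of length at least two in which `d x y < d x z` whenever `x`, `y`, `z` are consecutive
in either direction, the second vertex is strictly closer to both ends than these are to each
other. By the four-point condition this passes from the path without its first vertex to the whole
path. -/
theorem closer_of_isPath {V : Type*} {d : Sym2 V → ℝ} (h4 : FourPoint d) {H : SimpleGraph V}
    (hH : ∀ a b c, H.Adj a b → H.Adj b c → a ≠ c → d s(a, b) < d s(a, c))
    {y z : V} (p : H.Walk y z) {x : V} (h : H.Adj x y) (hp : (SimpleGraph.Walk.cons h p).IsPath)
    (hyz : y ≠ z) : Closer d y x z := by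
  induction p generalizing x with
  | nil => exact absurd rfl hyz
  | @cons y y' z h' p ih =>
    rw [SimpleGraph.Walk.cons_isPath_iff] at hp
    have hxy' : x ≠ y' := by
      rintro rfl
      exact hp.2 (by simp)
    have l1 := hH x y y' h h' hxy'
    have l2 := hH y' y x h'.symm h.symm hxy'.symm
    rw [Sym2.eq_swap (a := y') (b := x)] at l2
    by_cases hz : y' = z
    · subst hz
      exact ⟨by rwa [Sym2.eq_swap], by rwa [Sym2.eq_swap (a := y)]⟩
    obtain ⟨i1, i2⟩ := ih h' hp.1 hz
    have := h4 x y y' z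
    rw [Sym2.eq_swap (a := y') (b := y)] at i1 l2
    rw [le_max_iff] at this
    refine ⟨?_, ?_⟩
    · rw [Sym2.eq_swap]
      rcases this with h | h <;> linarith
    · rcases this with h | h <;> linarith

theorem DistinctDistances.lt_of_not_closer {V : Type*} {d : Sym2 V → ℝ}
    (hd : DistinctDistances d) {a b c : V} (hab : a ≠ b) (hbc : b ≠ c) (hac : a ≠ c)
    (h1 : ¬ Closer d c b a) (h2 : ¬ Closer d a b c) : d s(a, b) < d s(a, c) := by
  by_contra! h
  have hne : d s(a, c) ≠ d s(a, b) := fun e => by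
    have := hd _ _ (by simpa using hac) (by simpa using hab) e
    rw [Sym2.congr_right] at this
    exact hbc this.symm
  have h' : d s(a, c) < d s(a, b) := lt_of_le_of_ne h hne
  simp only [Closer, not_and, not_lt] at h1 h2
  rw [Sym2.eq_swap (a := c) (b := b), Sym2.eq_swap (a := b) (b := a),
    Sym2.eq_swap (a := c) (b := a)] at h1
  by_cases h3 : d s(b, c) < d s(a, b)
  · exact absurd h' (h1 h3).not_gt
  have h4 : d s(a, b) ≠ d s(b, c) := fun e => by
    have := hd _ _ (by simpa using hab) (by simpa using hbc) e
    rw [Sym2.eq_swap, Sym2.congr_right] at this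
    exact hac this
  have h5 : d s(a, b) < d s(b, c) := lt_of_le_of_ne (not_lt.1 h3) h4
  linarith [h2 h5]

/-! ### The relative neighbourhood graph is the minimum spanning tree -/

/-- The relative neighbourhood graph of the node set `S`: two distinct nodes of `S` are adjacent if
no node of `S` is strictly closer to both of them than they are to each other. -/
def relNbrGraph {V : Type*} (d : Sym2 V → ℝ) (S : Set V) : SimpleGraph V where
  Adj v w := v ≠ w ∧ v ∈ S ∧ w ∈ S ∧ ∀ u ∈ S, ¬ Closer d u v w
  symm := ⟨fun v w h => ⟨h.1.symm, h.2.2.1, h.2.1, fun u hu hc =>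
    h.2.2.2 u hu ⟨by rw [Sym2.eq_swap (a := v)]; exact hc.2, by
      rw [Sym2.eq_swap (a := v)]; exact hc.1⟩⟩⟩
  loopless := ⟨fun _ h => h.1 rfl⟩

theorem relNbrGraph_lt {V : Type*} {d : Sym2 V → ℝ} (hd : DistinctDistances d) {S : Set V}
    (a b c : V) (hab : (relNbrGraph d S).Adj a b) (hbc : (relNbrGraph d S).Adj b c)
    (hac : a ≠ c) : d s(a, b) < d s(a, c) :=
  hd.lt_of_not_closer hab.1 hbc.1 hac (hab.symm.2.2.2 _ hbc.2.2.1) (hbc.2.2.2 _ hab.2.1)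

/-- Induction on the distance of a pair of nodes. -/
theorem dist_induction {V : Type*} [Finite V] (d : Sym2 V → ℝ) {P : V → V → Prop}
    (h : ∀ v w, (∀ v' w', d s(v', w') < d s(v, w) → P v' w') → P v w) (v w : V) : P v w := by
  have : IsTrans (V × V) fun p q => d s(p.1, p.2) < d s(q.1, q.2) :=
    ⟨fun _ _ _ h1 h2 => lt_trans h1 h2⟩
  have : Std.Irrefl fun p q : V × V => d s(p.1, p.2) < d s(q.1, q.2) :=
    ⟨fun _ => lt_irrefl _⟩
  have wf : WellFounded fun p q : V × V => d s(p.1, p.2) < d s(q.1, q.2) :=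
    Finite.wellFounded_of_trans_of_irrefl _
  exact wf.induction (C := fun p => P p.1 p.2) (v, w) fun p ih => h _ _ fun v' w' hl =>
    ih (v', w') hl

theorem relNbrGraph_reachable {V : Type*} [Finite V] (d : Sym2 V → ℝ) {S : Set V} {v w : V}
    (hv : v ∈ S) (hw : w ∈ S) : (relNbrGraph d S).Reachable v w := by
  revert hv hw
  refine dist_induction d (P := fun v w => v ∈ S → w ∈ S → (relNbrGraph d S).Reachable v w)
    ?_ v w
  intro v w ih hv hw
  by_cases hvw : v = w
  · exact hvw ▸ SimpleGraph.Reachable.refl _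
  by_cases h : ∀ u ∈ S, ¬ Closer d u v w
  · exact SimpleGraph.Adj.reachable ⟨hvw, hv, hw, h⟩
  push Not at h
  obtain ⟨u, hu, h1, h2⟩ := h
  exact (ih u v h1 hu hv).symm.trans (ih u w h2 hu hw)

theorem connectsAll_iff {V : Type*} {S : Set V} {M : Finset (Sym2 V)} :
    ConnectsAll S M ↔ (∀ e ∈ M, ¬ e.IsDiag ∧ ∀ v ∈ e, v ∈ S) ∧ S.Nonempty ∧
      ∀ v ∈ S, ∀ w ∈ S, (SimpleGraph.fromEdgeSet (M : Set (Sym2 V))).Reachable v w := by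
  unfold ConnectsAll
  refine and_congr_right fun hM => ?_
  constructor
  · intro h
    obtain ⟨⟨x, hx⟩⟩ := h.nonempty
    exact ⟨⟨x, hx⟩, fun v hv w hw =>
      (h.preconnected ⟨v, hv⟩ ⟨w, hw⟩).map (SimpleGraph.Embedding.induce S).toHom⟩
  · rintro ⟨⟨x, hx⟩, h⟩
    have : Nonempty S := ⟨⟨x, hx⟩⟩
    refine SimpleGraph.Connected.mk ?_
    rintro ⟨v, hv⟩ ⟨w, hw⟩
    have hr := (SimpleGraph.reachable_iff_reflTransGen _ _).1 (h v hv w hw)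
    clear h
    induction hr with
    | refl => exact SimpleGraph.Reachable.refl _
    | @tail y z _ hyz ih =>
      have hyz' := (SimpleGraph.fromEdgeSet_adj _).1 hyz
      have hy : y ∈ S := (hM _ hyz'.1).2 _ (by simp)
      exact (ih hy).trans (SimpleGraph.Adj.reachable hyz)

/-- The exchange argument: in a minimum spanning tree, no node is closer to both ends of an edge,
since otherwise the edge could be exchanged for a shorter one. -/
theorem IsMST.not_closer {V : Type*} {d : Sym2 V → ℝ} (hd : ∀ e, 0 ≤ d e) {S : Set V}
    {M : Finset (Sym2 V)} (hM : IsMST d S M) {v w : V} (h : s(v, w) ∈ M) {u : V} (hu : u ∈ S) :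
    ¬ Closer d u v w := by
  classical
  intro hc
  obtain ⟨hM1, hM2⟩ := hM
  rw [connectsAll_iff] at hM1
  obtain ⟨hMe, hS, hMr⟩ := hM1
  have hv : v ∈ S := (hMe _ h).2 _ (by simp)
  have hw : w ∈ S := (hMe _ h).2 _ (by simp)
  set G0 := SimpleGraph.fromEdgeSet ((M.erase s(v, w) : Finset (Sym2 V)) : Set (Sym2 V)) with hG0
  have key : ∀ x ∈ S, G0.Reachable v x ∨ G0.Reachable w x := by
    intro x hx
    have hr := (SimpleGraph.reachable_iff_reflTransGen _ _).1 (hMr v hv x hx)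
    clear hx
    induction hr with
    | refl => exact Or.inl (SimpleGraph.Reachable.refl _)
    | @tail y z _ hyz ih =>
      rw [SimpleGraph.fromEdgeSet_adj] at hyz
      by_cases he : s(y, z) = s(v, w)
      · rcases Sym2.eq_iff.1 he with ⟨_, rfl⟩ | ⟨_, rfl⟩
        · exact Or.inr (SimpleGraph.Reachable.refl _)
        · exact Or.inl (SimpleGraph.Reachable.refl _)
      · have hadj : G0.Adj y z := by
          rw [hG0, SimpleGraph.fromEdgeSet_adj]
          exact ⟨by simpa [he] using hyz.1, hyz.2⟩
        exact ih.imp (·.trans hadj.reachable) (·.trans hadj.reachable)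
  -- Joining the two parts by an edge from `u` gives a cheaper connected graph.
  have main : ∀ a b, G0.Reachable a u → (∀ x ∈ S, G0.Reachable a x ∨ G0.Reachable b x) → b ∈ S →
      u ≠ b → ¬ d s(u, b) < d s(v, w) := by
    intro a b hau hab hb hub hlt
    have hcon : ConnectsAll S (insert s(u, b) (M.erase s(v, w))) := by
      rw [connectsAll_iff]
      refine ⟨?_, hS, ?_⟩
      · intro e he
        rcases Finset.mem_insert.1 he with rfl | he
        · refine ⟨by simpa using hub, fun x hx => ?_⟩
          rcases Sym2.mem_iff.1 hx with rfl | rfl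
          · exact hu
          · exact hb
        · exact hMe e (Finset.mem_of_mem_erase he)
      · set G1 := SimpleGraph.fromEdgeSet
          ((insert s(u, b) (M.erase s(v, w)) : Finset (Sym2 V)) : Set (Sym2 V)) with hG1
        have hle : G0 ≤ G1 := SimpleGraph.fromEdgeSet_mono
          (Finset.coe_subset.2 (Finset.subset_insert _ _))
        have hubr : G1.Reachable u b := SimpleGraph.Adj.reachable (by
          rw [hG1, SimpleGraph.fromEdgeSet_adj]
          exact ⟨by simp, hub⟩)
        have hbx : ∀ x ∈ S, G1.Reachable b x := fun x hx => by
          rcases hab x hx with hx | hx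
          · exact (hubr.symm.trans (hau.mono hle).symm).trans (hx.mono hle)
          · exact hx.mono hle
        exact fun x hx y hy => (hbx x hx).symm.trans (hbx y hy)
    have hle := hM2 _ hcon
    have h1 : ∑ e ∈ insert s(u, b) (M.erase s(v, w)), d e ≤
        d s(u, b) + ∑ e ∈ M.erase s(v, w), d e := by
      by_cases hin : s(u, b) ∈ M.erase s(v, w)
      · rw [Finset.insert_eq_of_mem hin]
        linarith [hd s(u, b)]
      · rw [Finset.sum_insert hin]
    have h2 := Finset.add_sum_erase M d h
    linarith
  rcases key u hu with h1 | h1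
  · refine main v w h1 key hw ?_ hc.2
    rintro rfl
    exact lt_irrefl _ (Sym2.eq_swap (a := v) (b := u) ▸ hc.1)
  · refine main w v h1 (fun x hx => (key x hx).symm) hv ?_ hc.1
    rintro rfl
    exact lt_irrefl _ hc.2

theorem IsMST.mem_iff {V : Type*} {d : Sym2 V → ℝ} (hd : ∀ e, 0 ≤ d e)
    (hdist : DistinctDistances d) (h4 : FourPoint d) {S : Set V}
    {M : Finset (Sym2 V)} (hM : IsMST d S M) {v w : V} :
    s(v, w) ∈ M ↔ (relNbrGraph d S).Adj v w := by
  classical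
  obtain ⟨hMe, hS, hMr⟩ := connectsAll_iff.1 hM.1
  have hsub : ∀ v w, s(v, w) ∈ M → (relNbrGraph d S).Adj v w := fun v w h =>
    ⟨by simpa using (hMe _ h).1, (hMe _ h).2 _ (by simp), (hMe _ h).2 _ (by simp),
      fun u hu => hM.not_closer hd h hu⟩
  refine ⟨hsub v w, fun h => ?_⟩
  obtain ⟨p, hp⟩ := (hMr v h.2.1 w h.2.2.1).exists_isPath
  cases p with
  | nil => exact absurd rfl h.1
  | @cons _ x _ hx p =>
    have hx' := (SimpleGraph.fromEdgeSet_adj _).1 hx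
    by_cases hxw : x = w
    · exact hxw ▸ hx'.1
    · refine absurd (closer_of_isPath h4 ?_ p hx hp hxw) (h.2.2.2 x (hsub _ _ hx'.1).2.2.1)
      intro a b c hab hbc hac
      exact relNbrGraph_lt hdist a b c (hsub _ _ ((SimpleGraph.fromEdgeSet_adj _).1 hab).1)
        (hsub _ _ ((SimpleGraph.fromEdgeSet_adj _).1 hbc).1) hac

theorem exists_isMST {V : Type*} [Fintype V] (d : Sym2 V → ℝ) {S : Set V} (hS : S.Nonempty) :
    ∃ M, IsMST d S M := by
  classical
  have hne : (Finset.univ.filter fun M : Finset (Sym2 V) => ConnectsAll S M).Nonempty := by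
    refine ⟨Finset.univ.filter fun e => ¬ e.IsDiag ∧ ∀ v ∈ e, v ∈ S, ?_⟩
    rw [Finset.mem_filter, connectsAll_iff]
    refine ⟨Finset.mem_univ _, fun e he => (Finset.mem_filter.1 he).2, hS, fun v hv w hw => ?_⟩
    by_cases hvw : v = w
    · exact hvw ▸ SimpleGraph.Reachable.refl _
    · refine SimpleGraph.Adj.reachable ((SimpleGraph.fromEdgeSet_adj _).2 ⟨?_, hvw⟩)
      simp [hvw, hv, hw]
  obtain ⟨M, hM, hmin⟩ := Finset.exists_min_image _ (fun M => ∑ e ∈ M, d e) hne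
  exact ⟨M, (Finset.mem_filter.1 hM).2, fun M' hM' =>
    hmin M' (Finset.mem_filter.2 ⟨Finset.mem_univ _, hM'⟩)⟩

/-- The valid edges are the edges of the relative neighbourhood graphs of the components. -/
theorem Config.valid_iff {V : Type*} [Fintype V] {d : Sym2 V → ℝ} (hd : ∀ e, 0 ≤ d e)
    (hdist : DistinctDistances d) (h4 : FourPoint d) (c : Config V) {v w : V} :
    c.Valid d v w ↔ (relNbrGraph d {x | c.graph.Reachable v x}).Adj v w := by
  have hsupp : (c.graph.connectedComponentMk v).supp = {x | c.graph.Reachable v x} := by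
    ext x
    exact SimpleGraph.ConnectedComponent.eq.trans SimpleGraph.reachable_comm
  constructor
  · rintro ⟨K, M, hM, h⟩
    have hK : K = c.graph.connectedComponentMk v :=
      (((connectsAll_iff.1 hM.1).1 _ h).2 v (by simp)).symm
    rwa [hM.mem_iff hd hdist h4, hK, hsupp] at h
  · intro h
    obtain ⟨M, hM⟩ := exists_isMST d (S := (c.graph.connectedComponentMk v).supp)
      ⟨v, rfl⟩
    refine ⟨_, M, hM, ?_⟩
    rwa [hM.mem_iff hd hdist h4, hsupp]

/-! ### The effect of a single step -/

theorem le_send {V : Type*} [DecidableEq V] (Q : V → Multiset V) (u w x : V) :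
    Q x ≤ send Q u w x := by
  unfold send
  by_cases h : x = u
  · subst h
    simpa using Multiset.le_cons_self _ _
  · simp [h]

theorem mem_send {V : Type*} [DecidableEq V] (Q : V → Multiset V) (u w : V) :
    w ∈ send Q u w u := by
  simp [send]

theorem eq_of_count_lt_send {V : Type*} [DecidableEq V] {Q : V → Multiset V} {u w x y : V}
    (h : (Q x).count y < (send Q u w x).count y) : x = u ∧ y = w := by
  unfold send at h
  by_cases hx : x = u
  · subst hx
    refine ⟨rfl, ?_⟩
    by_contra hy
    simp [Multiset.count_cons_of_ne hy] at h
  · simp [hx] at h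

/-- The relation between the memory `S` and the channels `Q` before the loop over `l` at the node
`v` and the memory `S'` and channels `Q'` after it. A processed reference that remains in memory
has been introduced, one that is gone has been delegated, and all new messages come from one of
these. No reference kept in the end would allow to delegate a processed one. -/
structure LoopSpec {V : Type*} [DecidableEq V] (d : Sym2 V → ℝ) (v : V) (l : List V)
    (S : Finset V) (Q : V → Multiset V) (S' : Finset V) (Q' : V → Multiset V) : Prop where
  subset : S' ⊆ S
  mem_of_notMem : ∀ w ∈ S, w ∉ l → w ∈ S'
  introduced : ∀ w ∈ l, w ∈ S' → v ∈ Q' w ∧ ∀ u ∈ S', ¬ Closer d u v w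
  delegated : ∀ w ∈ l, w ∉ S' → ∃ u ∈ S, Closer d u v w ∧ w ∈ Q' u
  le : ∀ x, Q x ≤ Q' x
  sent : ∀ x y, (Q x).count y < (Q' x).count y →
    (y = v ∧ x ∈ l ∧ x ∈ S') ∨ (x ∈ S ∧ y ∈ l ∧ y ∉ S' ∧ Closer d x v y)

theorem RunLoop.spec {V : Type*} [DecidableEq V] {d : Sym2 V → ℝ} {v : V} {l : List V}
    {S S' : Finset V} {Q Q' : V → Multiset V} (h : RunLoop d v l S Q S' Q') (hl : l.Nodup)
    (hlS : ∀ w ∈ l, w ∈ S) : LoopSpec d v l S Q S' Q' := by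
  induction h with
  | done S Q =>
    exact ⟨subset_rfl, fun _ h _ => h, by simp, by simp, fun _ => le_rfl,
      fun _ _ h => absurd h (lt_irrefl _)⟩
  | @delegate w u l S S' Q Q' hu huw h ih =>
    rw [List.nodup_cons] at hl
    have hs := ih hl.2 fun x hx => Finset.mem_erase.2
      ⟨fun e => hl.1 (e ▸ hx), hlS x (List.mem_cons_of_mem _ hx)⟩
    have hwS' : w ∉ S' := fun h => Finset.notMem_erase w S (hs.subset h)
    refine ⟨hs.subset.trans (Finset.erase_subset _ _), ?_, ?_, ?_,
      fun x => (le_send Q u w x).trans (hs.le x), ?_⟩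
    · intro x hx hxl
      rw [List.mem_cons, not_or] at hxl
      exact hs.mem_of_notMem x (Finset.mem_erase.2 ⟨hxl.1, hx⟩) hxl.2
    · intro x hx hxS
      rcases List.mem_cons.1 hx with rfl | hx
      · exact absurd hxS hwS'
      · exact hs.introduced x hx hxS
    · intro x hx hxS
      rcases List.mem_cons.1 hx with rfl | hx
      · exact ⟨u, hu, huw, Multiset.mem_of_le (hs.le u) (mem_send Q u x)⟩
      · obtain ⟨y, hy, h⟩ := hs.delegated x hx hxS
        exact ⟨y, Finset.mem_of_mem_erase hy, h⟩
    · intro x y hxy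
      by_cases hc : (Q x).count y < (send Q u w x).count y
      · obtain ⟨rfl, rfl⟩ := eq_of_count_lt_send hc
        exact Or.inr ⟨hu, by simp, hwS', huw⟩
      · rcases hs.sent x y ((not_lt.1 hc).trans_lt hxy) with ⟨h1, h2, h3⟩ | ⟨h1, h2, h3⟩
        · exact Or.inl ⟨h1, List.mem_cons_of_mem _ h2, h3⟩
        · exact Or.inr ⟨Finset.mem_of_mem_erase h1, List.mem_cons_of_mem _ h2, h3⟩
  | @introduce w l S S' Q Q' hw h ih =>
    rw [List.nodup_cons] at hl
    have hs := ih hl.2 fun x hx => hlS x (List.mem_cons_of_mem _ hx)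
    have hwS' : w ∈ S' := hs.mem_of_notMem w (hlS w (by simp)) hl.1
    refine ⟨hs.subset, ?_, ?_, ?_, fun x => (le_send Q w v x).trans (hs.le x), ?_⟩
    · intro x hx hxl
      rw [List.mem_cons, not_or] at hxl
      exact hs.mem_of_notMem x hx hxl.2
    · intro x hx hxS
      rcases List.mem_cons.1 hx with rfl | hx
      · exact ⟨Multiset.mem_of_le (hs.le x) (mem_send Q x v),
          fun u hu => hw u (hs.subset hu)⟩
      · exact hs.introduced x hx hxS
    · intro x hx hxS
      rcases List.mem_cons.1 hx with rfl | hx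
      · exact absurd hwS' hxS
      · exact hs.delegated x hx hxS
    · intro x y hxy
      by_cases hc : (Q x).count y < (send Q w v x).count y
      · obtain ⟨rfl, rfl⟩ := eq_of_count_lt_send hc
        exact Or.inl ⟨rfl, by simp, hwS'⟩
      · rcases hs.sent x y ((not_lt.1 hc).trans_lt hxy) with ⟨h1, h2, h3⟩ | ⟨h1, h2, h3⟩
        · exact Or.inl ⟨h1, List.mem_cons_of_mem _ h2, h3⟩
        · exact Or.inr ⟨h1, List.mem_cons_of_mem _ h2, h3⟩

namespace Config

variable {V : Type*}

/-- A reference to `y` is in the memory or in the channel of `x`. -/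
def Ref (c : Config V) (x y : V) : Prop := c.Explicit x y ∨ c.Implicit x y

theorem Ref.ne {c : Config V} {x y : V} (h : c.Ref x y) : x ≠ y := by
  rintro rfl
  exact h.elim (c.self_notMem_nbr x) (c.self_notMem_chan x)

theorem Ref.adj {c : Config V} {x y : V} (h : c.Ref x y) : c.graph.Adj x y :=
  (SimpleGraph.fromRel_adj _ _ _).2 ⟨h.ne, Or.inl h⟩

theorem ref_or_ref_of_adj {c : Config V} {x y : V} (h : c.graph.Adj x y) :
    c.Ref x y ∨ c.Ref y x :=
  ((SimpleGraph.fromRel_adj _ _ _).1 h).2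

/-- The graph of the edges of the configuration that are shorter than `L`. -/
def below (d : Sym2 V → ℝ) (c : Config V) (L : ℝ) : SimpleGraph V where
  Adj x y := c.graph.Adj x y ∧ d s(x, y) < L
  symm := ⟨fun x y h => ⟨h.1.symm, by rw [Sym2.eq_swap]; exact h.2⟩⟩
  loopless := ⟨fun _ h => h.1.ne rfl⟩

/-- `v` and `w` are connected by a path all of whose edges are shorter than `{v, w}`. Such an edge
`{v, w}` is not needed for a minimum spanning forest of the graph of the configuration. -/
def Short (d : Sym2 V → ℝ) (c : Config V) (v w : V) : Prop :=
  (c.below d (d s(v, w))).Reachable v w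

theorem below_le (d : Sym2 V → ℝ) (c : Config V) (L : ℝ) : c.below d L ≤ c.graph :=
  fun _ _ h => h.1

theorem Short.symm {d : Sym2 V → ℝ} {c : Config V} {v w : V} (h : c.Short d v w) :
    c.Short d w v := by
  unfold Short at *
  rw [Sym2.eq_swap]
  exact h.symm

theorem Short.of_below_le {d : Sym2 V → ℝ} {c c' : Config V}
    (hcc : ∀ L x y, (c.below d L).Adj x y → (c'.below d L).Reachable x y)
    {v w : V} (h : c.Short d v w) : c'.Short d v w := by
  unfold Short at *
  generalize d s(v, w) = L at *
  rw [SimpleGraph.reachable_iff_reflTransGen] at h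
  induction h with
  | refl => exact SimpleGraph.Reachable.refl _
  | tail _ hxy ih => exact ih.trans (hcc _ _ _ hxy)

end Config

/-- All that the proof uses about a step from `c` to `c'` in which `v` is activated and receives
the messages `D`. The new messages are described in comparison with the channels
`Function.update c.chan v (c.chan v - D)` after the delivery. -/
structure StepSpec {V : Type*} [DecidableEq V] (d : Sym2 V → ℝ) (v : V) (D : Multiset V)
    (c c' : Config V) : Prop where
  le_chan : D ≤ c.chan v
  subset : c'.nbr v ⊆ c.nbr v ∪ D.toFinset
  introduced : ∀ w ∈ c'.nbr v, v ∈ c'.chan w ∧ ∀ u ∈ c'.nbr v, ¬ Closer d u v w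
  delegated : ∀ w ∈ c.nbr v ∪ D.toFinset, w ∉ c'.nbr v →
    ∃ u ∈ c.nbr v ∪ D.toFinset, Closer d u v w ∧ w ∈ c'.chan u
  le : ∀ x, Function.update c.chan v (c.chan v - D) x ≤ c'.chan x
  sent : ∀ x y, (Function.update c.chan v (c.chan v - D) x).count y < (c'.chan x).count y →
    (y = v ∧ x ∈ c'.nbr v) ∨
      (x ∈ c.nbr v ∪ D.toFinset ∧ y ∈ c.nbr v ∪ D.toFinset ∧ y ∉ c'.nbr v ∧ Closer d x v y)
  nbr_eq : ∀ w, w ≠ v → c'.nbr w = c.nbr w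

namespace Step

variable {V : Type*} [DecidableEq V] {d : Sym2 V → ℝ} {v : V} {D : Multiset V} {c c' : Config V}

theorem spec (h : Step d v D c c') : StepSpec d v D c c' := by
  obtain ⟨hD, ⟨l, hl, hlS, hrun⟩, hnbr⟩ := h
  have hmem : ∀ w, w ∈ l ↔ w ∈ c.nbr v ∪ D.toFinset := fun w => by
    rw [← hlS, List.mem_toFinset]
  have hs := hrun.spec hl fun w hw => (hmem w).1 hw
  refine ⟨hD, hs.subset, fun w hw => hs.introduced w ((hmem w).2 (hs.subset hw)) hw,
    fun w hw => hs.delegated w ((hmem w).2 hw), hs.le, fun x y hxy => ?_, hnbr⟩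
  rcases hs.sent x y hxy with ⟨h1, _, h3⟩ | ⟨h1, h2, h3⟩
  · exact Or.inl ⟨h1, h3⟩
  · exact Or.inr ⟨h1, (hmem y).1 h2, h3⟩

end Step

namespace StepSpec

variable {V : Type*} [DecidableEq V] {d : Sym2 V → ℝ} {v : V} {D : Multiset V} {c c' : Config V}

theorem ref_of_mem (h : StepSpec d v D c c') {w : V} (hw : w ∈ c.nbr v ∪ D.toFinset) :
    c.Ref v w := by
  rcases Finset.mem_union.1 hw with hw | hw
  · exact Or.inl hw
  · exact Or.inr (Multiset.mem_of_le h.le_chan (Multiset.mem_toFinset.1 hw))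

theorem explicit_of_ne (h : StepSpec d v D c c') {x y : V} (hx : x ≠ v) :
    c'.Explicit x y ↔ c.Explicit x y := by
  unfold Config.Explicit
  rw [h.nbr_eq x hx]

theorem implicit_of_ne (h : StepSpec d v D c c') {x y : V} (hx : x ≠ v)
    (hxy : c.Implicit x y) : c'.Implicit x y := by
  have := h.le x
  rw [Function.update_of_ne hx] at this
  exact Multiset.mem_of_le this hxy

/-- A reference either survives a step or is processed in it. -/
theorem ref_or_mem (h : StepSpec d v D c c') {x y : V} (hxy : c.Ref x y) :
    c'.Ref x y ∨ x = v ∧ y ∈ c.nbr v ∪ D.toFinset := by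
  by_cases hx : x = v
  · subst hx
    by_cases hy : y ∈ c.nbr x ∪ D.toFinset
    · exact Or.inr ⟨rfl, hy⟩
    · left
      right
      rw [Finset.mem_union, not_or, Multiset.mem_toFinset] at hy
      have h1 := h.le x
      rw [Function.update_self] at h1
      refine Multiset.mem_of_le h1 ?_
      rw [Multiset.mem_sub, Multiset.count_eq_zero_of_notMem hy.2]
      exact Multiset.count_pos.2 (hxy.resolve_left hy.1)
  · exact Or.inl (hxy.imp (h.explicit_of_ne hx).2 (h.implicit_of_ne hx))

/-- A message in a channel after the step was there before, or is an introduction or a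
delegation. -/
theorem implicit_cases (h : StepSpec d v D c c') {x y : V} (hxy : c'.Implicit x y) :
    c.Implicit x y ∨ (y = v ∧ x ∈ c'.nbr v) ∨
      (x ∈ c.nbr v ∪ D.toFinset ∧ y ∈ c.nbr v ∪ D.toFinset ∧ y ∉ c'.nbr v ∧ Closer d x v y) := by
  by_cases hlt : (Function.update c.chan v (c.chan v - D) x).count y < (c'.chan x).count y
  · exact Or.inr (h.sent x y hlt)
  · left
    have h1 : y ∈ Function.update c.chan v (c.chan v - D) x :=
      Multiset.count_pos.1 ((Multiset.count_pos.2 hxy).trans_le (not_lt.1 hlt))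
    by_cases hx : x = v
    · subst hx
      rw [Function.update_self] at h1
      exact Multiset.mem_of_le (Multiset.sub_le_self _ _) h1
    · rwa [Function.update_of_ne hx] at h1

theorem explicit_of_not_closer (h : StepSpec d v D c c') {x y : V} (hxy : c.Explicit x y)
    (hs : ∀ u, c.graph.Reachable x u → ¬ Closer d u x y) : c'.Explicit x y := by
  by_cases hx : x = v
  · subst hx
    by_contra hy
    obtain ⟨u, hu, hc, _⟩ := h.delegated y (Finset.mem_union_left _ hxy) hy
    exact hs u (h.ref_of_mem hu).adj.reachable hc
  · exact (h.explicit_of_ne hx).2 hxy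

variable [Finite V]

/-- The endpoints of a processed reference stay connected without using longer edges. -/
theorem below_reachable_of_mem (h : StepSpec d v D c c') {y : V}
    (hy : y ∈ c.nbr v ∪ D.toFinset) {L : ℝ} (hL : d s(v, y) < L) :
    (c'.below d L).Reachable v y := by
  revert hy hL
  suffices H : ∀ a b : V, a = v → b ∈ c.nbr v ∪ D.toFinset → d s(a, b) < L →
      (c'.below d L).Reachable a b from H v y rfl
  refine dist_induction d ?_
  rintro a w ih rfl hw hL
  by_cases hw' : w ∈ c'.nbr a
  · exact SimpleGraph.Adj.reachable ⟨Config.Ref.adj (Or.inl hw'), hL⟩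
  · obtain ⟨u, hu, ⟨hc1, hc2⟩, hwu⟩ := h.delegated w hw hw'
    rw [Sym2.eq_swap] at hc1
    exact (ih a u hc1 rfl hu (hc1.trans hL)).trans
      (SimpleGraph.Adj.reachable ⟨Config.Ref.adj (Or.inr hwu), hc2.trans hL⟩)

/-- A delegated edge is replaced by a path of shorter edges. -/
theorem short_of_delegated (h : StepSpec d v D c c') {w : V}
    (hw : w ∈ c.nbr v ∪ D.toFinset) (hw' : w ∉ c'.nbr v) : c'.Short d v w := by
  obtain ⟨u, hu, ⟨hc1, hc2⟩, hwu⟩ := h.delegated w hw hw'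
  rw [Sym2.eq_swap] at hc1
  exact (h.below_reachable_of_mem hu hc1).trans
    (SimpleGraph.Adj.reachable ⟨Config.Ref.adj (Or.inr hwu), hc2⟩)

theorem below_reachable (h : StepSpec d v D c c') (L : ℝ) (x y : V)
    (hxy : (c.below d L).Adj x y) : (c'.below d L).Reachable x y := by
  have key : ∀ x y, c.Ref x y → d s(x, y) < L → (c'.below d L).Reachable x y := by
    intro x y hr hL
    rcases h.ref_or_mem hr with h1 | ⟨rfl, h1⟩
    · exact SimpleGraph.Adj.reachable ⟨h1.adj, hL⟩
    · exact h.below_reachable_of_mem h1 hL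
  rcases Config.ref_or_ref_of_adj hxy.1 with h1 | h1
  · exact key x y h1 hxy.2
  · exact (key y x h1 (by rw [Sym2.eq_swap]; exact hxy.2)).symm

theorem short_mono (h : StepSpec d v D c c') {x y : V} (hxy : c.Short d x y) :
    c'.Short d x y :=
  hxy.of_below_le h.below_reachable

theorem explicit_of_not_short (h : StepSpec d v D c c') {x y : V} (hxy : c.Explicit x y)
    (hs : ¬ c'.Short d x y) : c'.Explicit x y := by
  by_cases hx : x = v
  · subst hx
    by_contra hy
    exact hs (h.short_of_delegated (Finset.mem_union_left _ hxy) hy)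
  · exact (h.explicit_of_ne hx).2 hxy

theorem ref_of_not_short (h : StepSpec d v D c c') {x y : V} (hxy : c.Ref x y)
    (hs : ¬ c'.Short d x y) : c'.Ref x y := by
  rcases h.ref_or_mem hxy with h1 | ⟨rfl, h1⟩
  · exact h1
  · by_contra hy
    exact hs (h.short_of_delegated h1 fun h2 => hy (Or.inl h2))

/-- A step does not change the connected components. -/
theorem reachable_iff (h : StepSpec d v D c c') (x y : V) :
    c'.graph.Reachable x y ↔ c.graph.Reachable x y := by
  have hmem : ∀ w ∈ c.nbr v ∪ D.toFinset, c.graph.Reachable v w :=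
    fun w hw => (h.ref_of_mem hw).adj.reachable
  have key : ∀ x y, c'.Ref x y → c.graph.Reachable x y := by
    rintro x y (hr | hr)
    · by_cases hx : x = v
      · subst hx
        exact hmem y (h.subset hr)
      · exact (Config.Ref.adj (Or.inl ((h.explicit_of_ne hx).1 hr))).reachable
    · rcases h.implicit_cases hr with h1 | ⟨rfl, h1⟩ | ⟨h1, h2, _⟩
      · exact (Config.Ref.adj (Or.inr h1)).reachable
      · exact (hmem x (h.subset h1)).symm
      · exact (hmem x h1).symm.trans (hmem y h2)
  constructor <;> intro hr <;> rw [SimpleGraph.reachable_iff_reflTransGen] at hr <;>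
    induction hr with
    | refl => exact SimpleGraph.Reachable.refl _
    | @tail a b _ hab ih => ?_
  · rcases Config.ref_or_ref_of_adj hab with h1 | h1
    · exact ih.trans (key a b h1)
    · exact ih.trans (key b a h1).symm
  · exact ih.trans ((h.below_reachable (d s(a, b) + 1) a b ⟨hab, lt_add_one _⟩).mono
      (Config.below_le _ _ _))

end StepSpec

/-! ### Computations and rounds -/

/-- The edges that are not short suffice to connect the components. -/
theorem Config.reachable_of_adj_imp {V : Type*} [Finite V] {d : Sym2 V → ℝ} {c : Config V}
    {H : SimpleGraph V} (hH : ∀ x y, c.graph.Adj x y → ¬ c.Short d x y → H.Adj x y) {x y : V}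
    (h : c.graph.Reachable x y) : H.Reachable x y := by
  have key : ∀ x y, c.graph.Adj x y → H.Reachable x y := fun x y => by
    refine dist_induction d (P := fun x y => c.graph.Adj x y → H.Reachable x y) ?_ x y
    intro x y ih hxy
    by_cases hs : c.Short d x y
    · unfold Config.Short at hs
      rw [SimpleGraph.reachable_iff_reflTransGen] at hs
      have : ∀ z, Relation.ReflTransGen (c.below d (d s(x, y))).Adj x z → H.Reachable x z := by
        intro z hz
        induction hz with
        | refl => exact SimpleGraph.Reachable.refl _
        | tail _ hab ih' => exact ih'.trans (ih _ _ hab.2 hab.1)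
      exact this y hs
    · exact (hH x y hxy hs).reachable
  rw [SimpleGraph.reachable_iff_reflTransGen] at h
  induction h with
  | refl => exact SimpleGraph.Reachable.refl _
  | tail _ hab ih => exact ih.trans (key _ _ hab)

theorem deliveredCount_succ {V : Type*} [DecidableEq V] (act : ℕ → V) (del : ℕ → Multiset V)
    {a t : ℕ} (h : a ≤ t) (v w : V) :
    deliveredCount act del a (t + 1) v w =
      deliveredCount act del a t v w + if act t = v then (del t).count w else 0 :=
  Finset.sum_Ico_succ_top h _

theorem deliveredCount_mono {V : Type*} [DecidableEq V] (act : ℕ → V) (del : ℕ → Multiset V)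
    {a b b' : ℕ} (h : b ≤ b') (v w : V) :
    deliveredCount act del a b v w ≤ deliveredCount act del a b' v w :=
  Finset.sum_le_sum_of_subset (Finset.Ico_subset_Ico_right h)

namespace BuildMSTRun

variable {V : Type*} [DecidableEq V] {d : Sym2 V → ℝ} (X : BuildMSTRun d)

theorem stepSpec (t : ℕ) :
    StepSpec d (X.act t) (X.del t) (X.conf t) (X.conf (t + 1)) :=
  (X.step t).spec

theorem IsRound.lt {X : BuildMSTRun d} {a b : ℕ} (h : X.IsRound a b) : a < b := by
  obtain ⟨t, h1, h2, _⟩ := h.1 (X.act 0)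
  exact h1.trans_lt h2

theorem IsRoundDivision.monotone {X : BuildMSTRun d} {r : ℕ → ℕ} (h : X.IsRoundDivision r) :
    Monotone r :=
  monotone_nat_of_le_succ fun i => (h.2 i).lt.le

theorem IsRound.exists_delivery {X : BuildMSTRun d} {a b : ℕ} (h : X.IsRound a b) {v w : V}
    (hvw : (X.conf a).Implicit v w) : ∃ t, a ≤ t ∧ t < b ∧ X.act t = v ∧ w ∈ X.del t := by
  have h1 : 0 < deliveredCount X.act X.del a b v w :=
    (Multiset.count_pos.2 hvw).trans_le (h.2 v w)
  obtain ⟨t, ht, h2⟩ := Finset.exists_ne_zero_of_sum_ne_zero h1.ne'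
  rw [Finset.mem_Ico] at ht
  by_cases h3 : X.act t = v
  · rw [if_pos h3] at h2
    exact ⟨t, ht.1, ht.2, h3, Multiset.count_ne_zero.1 h2⟩
  · rw [if_neg h3] at h2
    exact absurd rfl h2

variable [Finite V]

theorem reachable_iff (t : ℕ) (x y : V) :
    (X.conf t).graph.Reachable x y ↔ (X.conf 0).graph.Reachable x y := by
  induction t with
  | zero => rfl
  | succ t ih => rw [(X.stepSpec t).reachable_iff, ih]

theorem short_mono {s t : ℕ} (h : s ≤ t) {x y : V} (hs : (X.conf s).Short d x y) :
    (X.conf t).Short d x y := by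
  induction t, h using Nat.le_induction with
  | base => exact hs
  | succ t _ ih => exact (X.stepSpec t).short_mono ih

theorem explicit_of_not_short {s t : ℕ} (h : s ≤ t) {x y : V} (hxy : (X.conf s).Explicit x y)
    (hs : ¬ (X.conf t).Short d x y) : (X.conf t).Explicit x y := by
  induction t, h using Nat.le_induction with
  | base => exact hxy
  | succ t _ ih =>
    exact (X.stepSpec t).explicit_of_not_short
      (ih fun h => hs (X.short_mono t.le_succ h)) hs

theorem ref_of_not_short {s t : ℕ} (h : s ≤ t) {x y : V} (hxy : (X.conf s).Ref x y)
    (hs : ¬ (X.conf t).Short d x y) : (X.conf t).Ref x y := by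
  induction t, h using Nat.le_induction with
  | base => exact hxy
  | succ t _ ih =>
    exact (X.stepSpec t).ref_of_not_short (ih fun h => hs (X.short_mono t.le_succ h)) hs

namespace IsRound

variable {X} {a b : ℕ}

theorem explicit_of_ref (h : X.IsRound a b) {x y : V} (hxy : (X.conf a).Ref x y)
    (hs : ¬ (X.conf b).Short d x y) : (X.conf b).Explicit x y := by
  rcases hxy with hxy | hxy
  · exact X.explicit_of_not_short h.lt.le hxy hs
  · obtain ⟨t, _, htb, rfl, hy⟩ := h.exists_delivery hxy
    refine X.explicit_of_not_short (Nat.succ_le_of_lt htb) ?_ hs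
    by_contra hn
    exact hs (X.short_mono (Nat.succ_le_of_lt htb) ((X.stepSpec t).short_of_delegated
      (Finset.mem_union_right _ (Multiset.mem_toFinset.2 hy)) hn))

theorem ref_symm (h : X.IsRound a b) {x y : V} (hxy : (X.conf a).Explicit x y)
    (hs : ¬ (X.conf b).Short d x y) : (X.conf b).Ref y x := by
  obtain ⟨t, hat, htb, rfl⟩ := h.1 x
  have h1 := X.explicit_of_not_short (hat.trans t.le_succ) hxy
    fun h' => hs (X.short_mono (Nat.succ_le_of_lt htb) h')
  exact X.ref_of_not_short (Nat.succ_le_of_lt htb)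
    (Or.inr ((X.stepSpec t).introduced _ h1).1) fun h' => hs h'.symm

theorem not_closer (h : X.IsRound a b) {u x y : V} (hxy : (X.conf a).Explicit x y)
    (hxu : (X.conf a).Explicit x u) (hsy : ¬ (X.conf b).Short d x y)
    (hsu : ¬ (X.conf b).Short d x u) : ¬ Closer d u x y := by
  obtain ⟨t, hat, htb, rfl⟩ := h.1 x
  have h1 := X.explicit_of_not_short (hat.trans t.le_succ) hxy
    fun h' => hsy (X.short_mono (Nat.succ_le_of_lt htb) h')
  have h2 := X.explicit_of_not_short (hat.trans t.le_succ) hxu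
    fun h' => hsu (X.short_mono (Nat.succ_le_of_lt htb) h')
  exact ((X.stepSpec t).introduced _ h1).2 u h2

end IsRound

/-- The edges that are present and do not become short during three rounds are explicit in both
directions afterwards. -/
theorem IsRoundDivision.explicit {X : BuildMSTRun d} {r : ℕ → ℕ} (h : X.IsRoundDivision r)
    {i : ℕ} {x y : V} (hxy : (X.conf (r i)).graph.Adj x y)
    (hs : ¬ (X.conf (r (i + 3))).Short d x y) : (X.conf (r (i + 3))).Explicit x y := by
  have key : ∀ x y, (X.conf (r i)).Ref x y → ¬ (X.conf (r (i + 3))).Short d x y →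
      (X.conf (r (i + 3))).Explicit x y ∧ (X.conf (r (i + 3))).Explicit y x := by
    intro x y hr hs
    have h1 := (h.2 i).explicit_of_ref hr
      fun h' => hs (X.short_mono (h.monotone (by omega)) h')
    have h2 := (h.2 (i + 1)).ref_symm h1
      fun h' => hs (X.short_mono (h.monotone (by omega)) h')
    exact ⟨X.explicit_of_not_short (h.monotone (by omega)) h1 hs,
      (h.2 (i + 2)).explicit_of_ref h2 fun h' => hs h'.symm⟩
  rcases Config.ref_or_ref_of_adj hxy with h1 | h1
  · exact (key x y h1 hs).1
  · exact (key y x h1 fun h' => hs h'.symm).2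

/-- The nodes of the connected component of `v`, which is the same in all configurations. -/
def component (v : V) : Set V := {x | (X.conf 0).graph.Reachable v x}

/-- If no pair becomes short during four rounds, then all edges of the relative neighbourhood graphs
are explicit. The edges that are not short connect the components and are explicit in both
directions after three rounds. Each node is activated in the fourth round, and as it does not
delegate any of these edges, they satisfy the hypothesis of `closer_of_isPath`. So their path
between the ends of an edge of a relative neighbourhood graph has length one. -/
theorem IsRoundDivision.explicit_of_relNbrGraph {X : BuildMSTRun d} {r : ℕ → ℕ}
    (h : X.IsRoundDivision r) (hdist : DistinctDistances d) (h4 : FourPoint d) {i : ℕ}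
    (hi : ∀ x y, (X.conf (r (i + 4))).Short d x y → (X.conf (r i)).Short d x y) {v w : V}
    (hvw : (relNbrGraph d (X.component v)).Adj v w) : (X.conf (r (i + 3))).Explicit v w := by
  let H : SimpleGraph V :=
    { Adj x y := (X.conf (r i)).graph.Adj x y ∧ ¬ (X.conf (r i)).Short d x y
      symm := ⟨fun x y h => ⟨h.1.symm, fun h' => h.2 h'.symm⟩⟩
      loopless := ⟨fun _ h => h.1.ne rfl⟩ }
  have hexp : ∀ x y, H.Adj x y → (X.conf (r (i + 3))).Explicit x y := fun x y hxy =>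
    h.explicit hxy.1 fun h' => hxy.2 (hi x y (X.short_mono (h.monotone (by omega)) h'))
  have hclose : ∀ u x y, H.Adj x y → H.Adj x u → ¬ Closer d u x y := fun u x y hxy hxu =>
    (h.2 (i + 3)).not_closer (hexp x y hxy) (hexp x u hxu) (fun h' => hxy.2 (hi x y h'))
      (fun h' => hxu.2 (hi x u h'))
  have hr : H.Reachable v w := by
    refine Config.reachable_of_adj_imp (c := X.conf (r i)) (d := d) (H := H)
      (fun x y h1 h2 => ⟨h1, h2⟩) ?_
    rw [X.reachable_iff]
    exact hvw.2.2.1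
  obtain ⟨p, hp⟩ := hr.exists_isPath
  cases p with
  | nil => exact absurd rfl hvw.1
  | @cons _ x _ hx p =>
    by_cases hxw : x = w
    · exact hexp _ _ (hxw ▸ hx)
    · refine absurd (closer_of_isPath h4 ?_ p hx hp hxw) (hvw.2.2.2 x ?_)
      · intro a b c hab hbc hac
        exact hdist.lt_of_not_closer hab.ne hbc.ne hac (hclose c b a hab.symm hbc)
          (hclose a b c hbc hab.symm)
      · exact (X.reachable_iff (r i) v x).1 hx.1.reachable

/-- An explicit edge of the relative neighbourhood graph is never delegated. -/
theorem explicit_of_relNbrGraph {s t : ℕ} (hst : s ≤ t) {v w : V}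
    (hvw : (relNbrGraph d (X.component v)).Adj v w) (h : (X.conf s).Explicit v w) :
    (X.conf t).Explicit v w := by
  induction t, hst using Nat.le_induction with
  | base => exact h
  | succ t _ ih =>
    exact (X.stepSpec t).explicit_of_not_closer ih fun u hu =>
      hvw.2.2.2 u ((X.reachable_iff t v u).1 hu)

end BuildMSTRun

namespace BuildMSTRun

variable {V : Type*} [DecidableEq V] [Fintype V] {d : Sym2 V → ℝ} (X : BuildMSTRun d)

theorem valid_iff (hd : ∀ e, 0 ≤ d e) (hdist : DistinctDistances d) (h4 : FourPoint d) (t : ℕ)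
    {v w : V} : (X.conf t).Valid d v w ↔ (relNbrGraph d (X.component v)).Adj v w := by
  rw [Config.valid_iff hd hdist h4]
  simp only [X.reachable_iff t]
  rfl

theorem allValidExplicit_mono (hd : ∀ e, 0 ≤ d e) (hdist : DistinctDistances d)
    (h4 : FourPoint d) {s t : ℕ} (hst : s ≤ t) (h : (X.conf s).AllValidExplicit d) :
    (X.conf t).AllValidExplicit d := fun v w hvw => by
  have hvw' := (X.valid_iff hd hdist h4 t).1 hvw
  exact X.explicit_of_relNbrGraph hst hvw' (h v w ((X.valid_iff hd hdist h4 s).2 hvw'))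

/-! ### Emergence of the valid edges -/

/-- The number of short pairs can only increase, and it cannot exceed `N²`; so among the first
`N² + 1` blocks of four rounds there is one in which it stays the same. -/
theorem IsRoundDivision.allValidExplicit {X : BuildMSTRun d} {r : ℕ → ℕ}
    (h : X.IsRoundDivision r) (hd : ∀ e, 0 ≤ d e) (hdist : DistinctDistances d)
    (h4 : FourPoint d) {t : ℕ} (ht : r (4 * (Fintype.card V ^ 2 + 1)) ≤ t) :
    (X.conf t).AllValidExplicit d := by
  classical
  let A : ℕ → Finset (V × V) := fun j =>
    Finset.univ.filter fun p => (X.conf (r (4 * j))).Short d p.1 p.2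
  have hmono : ∀ j, A j ⊆ A (j + 1) := fun j p hp => by
    simp only [A, Finset.mem_filter, Finset.mem_univ, true_and] at hp ⊢
    exact X.short_mono (h.monotone (by omega)) hp
  have hex : ∃ j ≤ Fintype.card V ^ 2, A j = A (j + 1) := by
    by_contra! hne
    have hlow : ∀ j ≤ Fintype.card V ^ 2 + 1, j ≤ (A j).card := by
      intro j
      induction j with
      | zero => simp
      | succ j ih =>
        intro hj
        have := Finset.card_lt_card ((hmono j).ssubset_of_ne (hne j (by omega)))
        have := ih (by omega)
        omega
    have h1 := hlow _ le_rfl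
    have h2 : (A (Fintype.card V ^ 2 + 1)).card ≤ Fintype.card (V × V) := Finset.card_le_univ _
    rw [Fintype.card_prod, ← sq] at h2
    omega
  obtain ⟨j, hj, hA⟩ := hex
  have hs : ∀ x y, (X.conf (r (4 * j + 4))).Short d x y → (X.conf (r (4 * j))).Short d x y := by
    intro x y hxy
    have : (x, y) ∈ A (j + 1) := by
      simp only [A, Finset.mem_filter, Finset.mem_univ, true_and]
      exact hxy
    rw [← hA] at this
    simpa only [A, Finset.mem_filter, Finset.mem_univ, true_and] using this
  refine X.allValidExplicit_mono hd hdist h4 (s := r (4 * j + 3))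
    ((h.monotone (by omega)).trans ht) fun v w hvw => ?_
  exact h.explicit_of_relNbrGraph hdist h4 hs ((X.valid_iff hd hdist h4 _).1 hvw)

end BuildMSTRun

/-! ### Disappearance of the invalid edges -/

/-- The number of pairs of nodes with a larger distance than `v` and `w`. -/
noncomputable def rank {V : Type*} [Fintype V] (d : Sym2 V → ℝ) (v w : V) : ℕ :=
  (Finset.univ.filter fun p : V × V => d s(v, w) < d s(p.1, p.2)).card

theorem rank_lt_rank {V : Type*} [Fintype V] {d : Sym2 V → ℝ} {v w v' w' : V}
    (h : d s(v, w) < d s(v', w')) :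
    rank d v' w' < rank d v w := by
  refine Finset.card_lt_card (Finset.ssubset_iff_of_subset ?_ |>.2 ⟨(v', w'), ?_, ?_⟩)
  · intro p hp
    simp only [Finset.mem_filter, Finset.mem_univ, true_and] at hp ⊢
    exact h.trans hp
  · simpa using h
  · simp

theorem rank_lt_card {V : Type*} [Fintype V] (d : Sym2 V → ℝ) (v w : V) :
    rank d v w < Fintype.card V ^ 2 := by
  rw [sq, ← Fintype.card_prod]
  exact Finset.card_lt_univ_of_notMem (x := (v, w)) (by simp)

namespace BuildMSTRun

variable {V : Type*} [DecidableEq V] [Fintype V] {d : Sym2 V → ℝ} (X : BuildMSTRun d)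

/-- Once all valid edges are explicit, an activated node keeps no invalid ones: if `{v, w}` is
invalid, then the second node on the path from `v` to `w` in the minimum spanning tree is a
neighbour of `v` to which `w` can be delegated. -/
theorem valid_of_explicit (hd : ∀ e, 0 ≤ d e) (hdist : DistinctDistances d) (h4 : FourPoint d)
    {t : ℕ} (ht : (X.conf (t + 1)).AllValidExplicit d) {w : V}
    (hw : (X.conf (t + 1)).Explicit (X.act t) w) :
    (relNbrGraph d (X.component (X.act t))).Adj (X.act t) w := by
  have href : (X.conf (t + 1)).Ref (X.act t) w := Or.inl hw
  have hwc : w ∈ X.component (X.act t) := (X.reachable_iff _ _ _).1 href.adj.reachable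
  obtain ⟨p, hp⟩ := (relNbrGraph_reachable d (S := X.component (X.act t))
    (SimpleGraph.Reachable.refl _) hwc).exists_isPath
  have hne := href.ne
  generalize hv : X.act t = v at *
  cases p with
  | nil => exact absurd rfl hne
  | @cons _ x _ hx p =>
    by_cases hxw : x = w
    · exact hxw ▸ hx
    · have hc := closer_of_isPath h4 (relNbrGraph_lt hdist) p hx hp hxw
      have hxe := ht v x ((X.valid_iff hd hdist h4 _).2 hx)
      exact absurd hc (((hv ▸ X.stepSpec t).introduced w hw).2 x hxe)

/-- Once all valid edges are explicit, one round removes the longest invalid edges: all of them are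
processed and hence delegated, and each invalid edge that comes into being has been delegated along
a longer invalid edge. -/
theorem IsRound.lt_rank {X : BuildMSTRun d} {a b : ℕ} (h : X.IsRound a b) (hd : ∀ e, 0 ≤ d e)
    (hdist : DistinctDistances d) (h4 : FourPoint d) (ha : (X.conf a).AllValidExplicit d) {j : ℕ}
    (hj : ∀ t, a ≤ t → ∀ x y, (X.conf t).Ref x y → ¬ (X.conf t).Valid d x y → j ≤ rank d x y)
    {t : ℕ} (ht : b ≤ t) {x y : V} (hxy : (X.conf t).Ref x y)
    (hval : ¬ (X.conf t).Valid d x y) : j < rank d x y := by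
  have hall : ∀ t, a ≤ t → (X.conf t).AllValidExplicit d :=
    fun t ht => X.allValidExplicit_mono hd hdist h4 ht ha
  rw [X.valid_iff hd hdist h4] at hval
  by_contra! hrank
  rcases hxy with hxy | hxy
  · obtain ⟨s, has, hsb, rfl⟩ := h.1 x
    have key : ∀ t, s + 1 ≤ t → ∀ y, (X.conf t).Explicit (X.act s) y →
        (relNbrGraph d (X.component (X.act s))).Adj (X.act s) y := by
      intro t hst
      induction t, hst using Nat.le_induction with
      | base => exact fun y => X.valid_of_explicit hd hdist h4 (hall _ (by omega))
      | succ t hst ih =>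
        intro y hy
        by_cases hact : X.act s = X.act t
        · rw [hact] at hy ⊢
          exact X.valid_of_explicit hd hdist h4 (hall _ (by omega)) hy
        · exact ih y (((X.stepSpec t).explicit_of_ne hact).1 hy)
    exact hval (key t (by omega) y hxy)
  · -- No further message with a reference to `y` is sent to `x`.
    have hsent : ∀ t, a ≤ t → ((X.conf (t + 1)).chan x).count y ≤
        (Function.update (X.conf t).chan (X.act t) ((X.conf t).chan (X.act t) - X.del t) x).count
          y := by
      intro t hat
      by_contra! hlt
      rcases (X.stepSpec t).sent x y hlt with ⟨rfl, h1⟩ | ⟨_, h2, h3, h4'⟩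
      · have h5 := X.valid_of_explicit hd hdist h4 (hall _ (by omega)) h1
        have h6 : X.component x = X.component (X.act t) :=
          Set.ext fun z => ⟨h5.2.2.1.trans, h5.2.2.1.symm.trans⟩
        exact hval (h6 ▸ h5.symm)
      · have h5 : ¬ (X.conf t).Valid d (X.act t) y := fun hv => h3 <|
          hall (t + 1) (by omega) _ _
            ((X.valid_iff hd hdist h4 _).2 ((X.valid_iff hd hdist h4 _).1 hv))
        have h6 := hj t hat _ _ ((X.stepSpec t).ref_of_mem h2) h5
        have h7 := rank_lt_rank h4'.2
        omega
    have hcount : ∀ t, a ≤ t → ((X.conf t).chan x).count y +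
        deliveredCount X.act X.del a t x y ≤ ((X.conf a).chan x).count y := by
      intro t hat
      induction t, hat using Nat.le_induction with
      | base => simp [deliveredCount]
      | succ t hat ih =>
        have h1 := hsent t hat
        rw [deliveredCount_succ _ _ hat]
        by_cases hact : X.act t = x
        · have h2 := Multiset.count_le_of_le y (X.stepSpec t).le_chan
          subst hact
          rw [Function.update_self, Multiset.count_sub] at h1
          rw [if_pos rfl]
          omega
        · rw [Function.update_of_ne (Ne.symm hact)] at h1
          rw [if_neg hact]
          omega
    have h1 := hcount t (h.lt.le.trans ht)
    have h2 := h.2 x y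
    have h3 := deliveredCount_mono X.act X.del (a := a) ht x y
    have h4 : 0 < ((X.conf t).chan x).count y := Multiset.count_pos.2 hxy
    omega

theorem IsRoundDivision.noInvalid {X : BuildMSTRun d} {r : ℕ → ℕ} (h : X.IsRoundDivision r)
    (hd : ∀ e, 0 ≤ d e) (hdist : DistinctDistances d) (h4 : FourPoint d) {i : ℕ}
    (hi : (X.conf (r i)).AllValidExplicit d) {t : ℕ} (ht : r (i + Fintype.card V ^ 2) ≤ t) :
    (X.conf t).NoInvalid d := by
  have key : ∀ j t, r (i + j) ≤ t → ∀ x y, (X.conf t).Ref x y → ¬ (X.conf t).Valid d x y →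
      j ≤ rank d x y := by
    intro j
    induction j with
    | zero => exact fun _ _ _ _ _ _ => Nat.zero_le _
    | succ j ih =>
      intro t ht x y hxy hval
      exact (h.2 (i + j)).lt_rank hd hdist h4
        (X.allValidExplicit_mono hd hdist h4 (h.monotone (by omega)) hi) ih ht hxy hval
  intro v w hvw
  by_contra hval
  exact absurd (key _ t ht v w hvw hval) (rank_lt_card d v w).not_ge

end BuildMSTRun

theorem mainTheorem2 :
    ∃ C : ℕ, ∀ (V : Type*) [Fintype V] [DecidableEq V] (W : Type*) (T : WeightedTree W)
      (ι : V ↪ W), DistinctDistances (T.metricOn ι) →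
      ∀ (X : BuildMSTRun (T.metricOn ι)) (r : ℕ → ℕ), X.IsRoundDivision r →
        (∀ t, r (C * Fintype.card V ^ 2) ≤ t → (X.conf t).AllValidExplicit (T.metricOn ι)) ∧
        (∀ i, (X.conf (r i)).AllValidExplicit (T.metricOn ι) →
          ∀ t, r (i + C * Fintype.card V ^ 2) ≤ t → (X.conf t).NoInvalid (T.metricOn ι)) ∧
        (∀ t, r (C * Fintype.card V ^ 2) ≤ t → (X.conf t).Legal (T.metricOn ι)) := by
  -- The valid edges need `4 * (N ^ 2 + 1) ≤ 8 * N ^ 2` rounds, the invalid ones `N ^ 2` more.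
  refine ⟨9, fun V _ _ W T ι hdist X r hr => ?_⟩
  have hd := T.metricOn_nonneg ι
  have h4 := T.fourPoint_metricOn ι
  have hN : 0 < Fintype.card V ^ 2 := pow_pos (Fintype.card_pos_iff.2 ⟨X.act 0⟩) 2
  have h1 : ∀ t, r (8 * Fintype.card V ^ 2) ≤ t →
      (X.conf t).AllValidExplicit (T.metricOn ι) := fun t ht =>
    hr.allValidExplicit hd hdist h4 ((hr.monotone (by omega)).trans ht)
  have h2 : ∀ t, r (9 * Fintype.card V ^ 2) ≤ t → (X.conf t).NoInvalid (T.metricOn ι) :=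
    fun t ht => hr.noInvalid hd hdist h4 (h1 _ le_rfl) ((hr.monotone (by omega)).trans ht)
  refine ⟨fun t ht => h1 t ((hr.monotone (by omega)).trans ht), fun i hi t ht =>
    hr.noInvalid hd hdist h4 hi ((hr.monotone (by omega)).trans ht), fun t ht => ?_⟩
  exact ⟨fun v w => ⟨fun h => h2 t ht v w (Or.inl h),
    fun h => h1 t ((hr.monotone (by omega)).trans ht) v w h⟩,
    fun v w h => h2 t ht v w (Or.inr h)⟩
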